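/- Let $n=2m+1$ be an odd integer with $n\ge 3$ (so $m\ge 1$). For $(N_0,\dots,N_m)\in\mathbb Z^{m+1}$ put $$F_2(N_0,\dots,N_m)=2\sum_{k=0}^{m}N_k,\qquad G_2(N_0,\dots,N_m)=\sum_{k=0}^{m}\bigl(6k(k+1)-(m-1)\bigr)N_{m-k},$$ and let $$\mathcal Z_2=\{(N_0,\dots,N_m)\in(\mathbb Z_{\ge 0})^{m+1} : F_2(N_0,\dots,N_m)>0,\ G_2(N_0,\dots,N_m)=0\}.$$ Then $F_2$ attains a minimum $\mathcal B(n)$ on $\mathcal Z_2$. Let $r=\gcd(m-1,12)$, where $\gcd(0,12)=12$; a triangular number is a number of the form $k(k+1)/2$ with $k\in\mathbb Z_{\ge 0}$. (i) If $r\le 4$, then $\mathcal B(n)=24/r$. (ii) If $r=6$, then $\mathcal B(n)=4$ if every prime factor of $n/3$ congruent to $3 \pmod 4$ occurs in $n/3$ with even exponent, and $\mathcal B(n)=8$ otherwise. (iii) If $r=12$, then - $\mathcal B(n)=2$ if $\frac{n-3}{24}$ is a triangular number; - $\mathcal B(n)=4$ if $\frac{n-3}{24}$ is not a triangular number and every prime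 factor of $n/3$ congruent to $3\pmod 4$ occurs in $n/3$ with even exponent; - $\mathcal B(n)=6$ otherwise. Moreover, the set of values taken by $\mathcal B(n)$, as $n$ ranges over the odd integers $n\ge 3$, is exactly $\{2,4,6,8,12,24\}$. -/

import Mathlib

namespace FixedPointBound

/-- `F₂(N₀, …, N_m) = 2 ∑_{k=0}^m N_k`. -/
def F₂ (m : ℕ) (N : Fin (m + 1) → ℤ) : ℤ :=
  2 * ∑ k : Fin (m + 1), N k

/-- `G₂(N₀, …, N_m) = ∑_{k=0}^m (6k(k+1) - (m-1)) N_{m-k}`; the index `Fin.rev k` is `m - k`. -/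
def G₂ (m : ℕ) (N : Fin (m + 1) → ℤ) : ℤ :=
  ∑ k : Fin (m + 1), (6 * ((k : ℕ) : ℤ) * (((k : ℕ) : ℤ) + 1) - ((m : ℤ) - 1)) * N (Fin.rev k)

/-- The vectors of nonnegative integers with `F₂ > 0` and `G₂ = 0`. -/
def Z₂ (m : ℕ) : Set (Fin (m + 1) → ℤ) :=
  {N | (∀ i, 0 ≤ N i) ∧ 0 < F₂ m N ∧ G₂ m N = 0}

/-- The minimum of `F₂` on `Z₂` for `m = ⌊n/2⌋`, written as an infimum of integers
(that it is attained is part of the theorem). -/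
noncomputable def B (n : ℕ) : ℤ :=
  sInf (F₂ (n / 2) '' Z₂ (n / 2))

/-- `q = k(k+1)/2` for some `k = 0, 1, 2, …`. -/
def IsTriangular (q : ℚ) : Prop :=
  ∃ k : ℕ, q = (k : ℚ) * ((k : ℚ) + 1) / 2

/-- Every prime factor of `a` congruent to `3` modulo `4` occurs with even exponent. -/
def EvenExponents (a : ℕ) : Prop :=
  ∀ p : ℕ, p.Prime → p ∣ a → p ≡ 3 [MOD 4] → Even (a.factorization p)

end FixedPointBound

/-!
A vector `(N_0, …, N_m)` of nonnegative integers is a finite multiset `s` of indices `k ≤ m`, in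
which `k` occurs `N_{m-k}` times. In these terms `F₂ = 2 N` with `N` the number of elements of `s`,
and `G₂ = 0` says that twelve times the sum of the triangular numbers `k (k + 1) / 2`, `k ∈ s`, is
`(m - 1) N`. Hence `2 N` is a value of `F₂` on `Z₂` only if `12 ∣ (m - 1) N`, that is
`12 / r ∣ N` with `r = gcd (m - 1, 12)`, and for `N ≤ 12` it is a value exactly when moreover
`(m - 1) N / 12` is a sum of `N` triangular numbers; the requirement `k ≤ m` is then automatic.
The lemmas below write `d` for `m - 1`, so that no truncated subtraction occurs.

By Gauss's theorem (`exists_sum_three_triangular`) there is no further condition when `N ≥ 3`. So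
the minimum is `24 / r` if `12 / r ≥ 3`, and otherwise only `N = 1` and `N = 2` need attention:
`N = 1` asks for `(m - 1) / 12 = (n - 3) / 24` to be triangular, and `N = 2` asks for
`e = (m - 1) / 6` to be a sum of two triangular numbers, which holds exactly when
`4 e + 1 = n / 3` is a sum of two squares.

Gauss's theorem amounts to the statement that every `N ≡ 3 (mod 8)` is a sum of three squares
(`eq_sum_three_sq_of_mod_eight_eq_three`), proved here in the manner of Dirichlet. A positive
definite integral ternary form of determinant `1` takes only sums of three squares as values, by
reduction theory (`ternary_unimodular_eq_sum_three_sq`). A form of this kind taking the value `N` is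
given by the Gram matrix `!![a, x, 1; x, 2 p, 0; 1, 0, N]`, where `a = (b + x²) / (2 p)` and
`b N = 2 p + 1`. Dirichlet's theorem on primes in arithmetic progressions supplies a prime `p` with
`b ≡ 1 (mod 8)`, and quadratic reciprocity shows that `-b` is a square modulo `p`.
-/

namespace FixedPointBound

/-! ### Reduction of binary and ternary quadratic forms -/

/-- A multiple of `a` brings `b` into the interval `[-a/2, a/2]`. -/
lemma exists_abs_two_mul_shift_le {a : ℤ} (ha : 0 < a) (b : ℤ) :
    ∃ k : ℤ, -a ≤ 2 * (b + k * a) ∧ 2 * (b + k * a) ≤ a := by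
  refine ⟨-((2 * b + a) / (2 * a)), ?_, ?_⟩ <;>
  nlinarith [Int.emod_add_mul_ediv (2 * b + a) (2 * a),
    Int.emod_nonneg (2 * b + a) (by omega : 2 * a ≠ 0),
    Int.emod_lt_of_pos (2 * b + a) (by omega : 0 < 2 * a)]

/-- Gauss reduction of a positive definite binary form `A y² + 2 B y z + C z²` of
determinant `D`: some primitive vector `(p, r)`, completed to a unimodular matrix by `(q, s)`,
has a value `A'` with `3 A'² ≤ 4 D`. -/
lemma exists_unimodular_binary_reduction {D : ℤ} (hD : 0 < D) (A B C : ℤ) (hA : 0 < A)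
    (hdet : A * C - B ^ 2 = D) :
    ∃ p q r s : ℤ, p * s - q * r = 1 ∧ 0 < A * p ^ 2 + 2 * B * p * r + C * r ^ 2 ∧
      3 * (A * p ^ 2 + 2 * B * p * r + C * r ^ 2) ^ 2 ≤ 4 * D := by
  induction hn : A.toNat using Nat.strong_induction_on generalizing A B C with
  | _ n ih =>
  obtain ⟨k, hk1, hk2⟩ := exists_abs_two_mul_shift_le hA B
  -- the substitution `y = y' + k z'` turns the middle coefficient into `B + k A`
  set B' := B + k * A with hB'
  set C' := A * k ^ 2 + 2 * B * k + C with hC'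
  have hdet' : A * C' - B' ^ 2 = D := by rw [hC', hB', ← hdet]; ring
  by_cases hCA : C' < A
  · -- exchanging the two variables gives a smaller leading coefficient
    have hC'0 : 0 < C' := by
      by_contra h
      nlinarith [sq_nonneg B', mul_nonneg hA.le (sub_nonneg.2 (not_lt.1 h))]
    obtain ⟨p, q, r, s, h1, h2, h3⟩ := ih C'.toNat (by omega) C' (-B') A hC'0
      (by rw [← hdet']; ring) rfl
    have e : A * (k * p - r) ^ 2 + 2 * B * (k * p - r) * p + C * p ^ 2 =
        C' * p ^ 2 + 2 * (-B') * p * r + A * r ^ 2 := by rw [hC', hB']; ring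
    exact ⟨k * p - r, k * q - s, p, q, by linear_combination h1, by rwa [e], by rwa [e]⟩
  · -- `A ≤ C'` and `2 |B'| ≤ A` give `A² ≤ A C' = D + B'² ≤ D + A² / 4`
    refine ⟨1, 0, 0, 1, by ring, by simpa using hA, ?_⟩
    have : 4 * B' ^ 2 ≤ A ^ 2 := by nlinarith
    nlinarith

/-- A positive definite binary form of determinant `1` takes only sums of two squares as values. -/
lemma binary_unimodular_eq_sum_two_sq {A B C : ℤ} (hA : 0 < A) (hdet : A * C - B ^ 2 = 1)
    (y z : ℤ) : ∃ v w : ℤ, A * y ^ 2 + 2 * B * y * z + C * z ^ 2 = v ^ 2 + w ^ 2 := by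
  obtain ⟨p, q, r, s, h1, h2, h3⟩ := exists_unimodular_binary_reduction one_pos A B C hA hdet
  set A' := A * p ^ 2 + 2 * B * p * r + C * r ^ 2 with hA'
  have hA1 : A' = 1 := by nlinarith
  -- the coordinates of `(y, z)` in the reduced basis
  set y' := s * y - q * z
  set z' := p * z - r * y
  set B' := A * p * q + B * (p * s + q * r) + C * r * s
  set C' := A * q ^ 2 + 2 * B * q * s + C * s ^ 2
  have hdet' : A' * C' - B' ^ 2 = 1 := by
    have : A' * C' - B' ^ 2 = (A * C - B ^ 2) * (p * s - q * r) ^ 2 := by ring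
    rw [this, hdet, h1]; ring
  have hy : y = p * y' + q * z' := by linear_combination -y * h1
  have hz : z = r * y' + s * z' := by linear_combination -z * h1
  refine ⟨y' + B' * z', z', ?_⟩
  have : A * y ^ 2 + 2 * B * y * z + C * z ^ 2 = A' * y' ^ 2 + 2 * B' * y' * z' + C' * z' ^ 2 := by
    rw [hy, hz]; ring
  rw [this]
  rw [hA1] at hdet' ⊢
  linear_combination z' ^ 2 * hdet'

/-- The numerical estimate behind reduction of ternary forms: a form with leading coefficients
`a, b` and off-diagonal entry `f`, whose `2 × 2` minor is as small as binary reduction makes it,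
has `b < a` unless `a = 1`. -/
lemma second_coeff_lt_of_reduced {a b f : ℤ} (ha : 2 ≤ a) (hf : |2 * f| ≤ a)
    (hpos : 0 < a * b - f ^ 2) (hle : 3 * (a * b - f ^ 2) ^ 2 ≤ 4 * a) : 0 < b ∧ b < a := by
  have ha0 : 0 < a := by omega
  have hf4 : (2 * f) ^ 2 ≤ a ^ 2 := sq_le_sq' (abs_le.1 hf).1 (abs_le.1 hf).2
  refine ⟨pos_of_mul_pos_right (lt_of_le_of_lt (sq_nonneg f) (by linarith)) ha0.le, ?_⟩
  by_contra! h
  have h4 : 3 * a ^ 2 ≤ 4 * (a * b - f ^ 2) := by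
    have : a * a ≤ a * b := mul_le_mul_of_nonneg_left h ha0.le
    linarith
  have h5 : (3 * a ^ 2) ^ 2 ≤ (4 * (a * b - f ^ 2)) ^ 2 :=
    pow_le_pow_left₀ (by positivity) h4 2
  -- `27 a⁴ ≤ 64 a` is impossible for `a ≥ 2`
  have h6 : 27 * a ^ 3 ≤ 64 := le_of_mul_le_mul_left (by linarith : a * (27 * a ^ 3) ≤ a * 64) ha0
  have h7 : 2 ^ 3 ≤ a ^ 3 := pow_le_pow_left₀ (by norm_num) ha 3
  linarith

/-- Every value of a positive definite integral ternary form with Gram matrix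
`!![a, f, e; f, b, d; e, d, c]` of determinant `1` is a sum of three squares. The proof descends on
the leading coefficient `a`: reduction of the binary form that remains after completing the square
in `x` produces a basis vector with value less than `a`, unless `a = 1`. -/
theorem ternary_unimodular_eq_sum_three_sq (a b c d e f : ℤ) (ha : 0 < a)
    (hab : 0 < a * b - f ^ 2)
    (hdet : a * b * c + 2 * d * e * f - a * d ^ 2 - b * e ^ 2 - c * f ^ 2 = 1) (x y z : ℤ) :
    ∃ u v w : ℤ, a * x ^ 2 + b * y ^ 2 + c * z ^ 2 + 2 * d * y * z + 2 * e * x * z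
      + 2 * f * x * y = u ^ 2 + v ^ 2 + w ^ 2 := by
  induction hn : a.toNat using Nat.strong_induction_on generalizing a b c d e f x y z with
  | _ n ih =>
  -- `A y² + 2 B y z + C z²` is `a` times the form minus `(a x + f y + e z)²`
  obtain ⟨A, hA⟩ : ∃ A, A = a * b - f ^ 2 := ⟨_, rfl⟩
  obtain ⟨B, hB⟩ : ∃ B, B = a * d - e * f := ⟨_, rfl⟩
  obtain ⟨C, hC⟩ : ∃ C, C = a * c - e ^ 2 := ⟨_, rfl⟩
  have hABC : A * C - B ^ 2 = a := by
    rw [hA, hB, hC]; linear_combination a * hdet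
  by_cases ha1 : a = 1
  · subst ha1
    obtain ⟨v, w, h⟩ := binary_unimodular_eq_sum_two_sq (hA ▸ hab) hABC y z
    refine ⟨x + f * y + e * z, v, w, ?_⟩
    rw [hA, hB, hC] at h
    linear_combination h
  · obtain ⟨p, q, r, s, h1, h2, h3⟩ :=
      exists_unimodular_binary_reduction ha A B C (hA ▸ hab) hABC
    obtain ⟨k, hk1, hk2⟩ := exists_abs_two_mul_shift_le ha (f * p + e * r)
    -- in the basis `(1, 0, 0)`, `(k, p, r)`, `(0, q, s)`
    obtain ⟨f', hf'⟩ : ∃ f', f' = f * p + e * r + k * a := ⟨_, rfl⟩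
    obtain ⟨e', he'⟩ : ∃ e', e' = f * q + e * s := ⟨_, rfl⟩
    obtain ⟨b', hb'⟩ : ∃ b', b' = b * p ^ 2 + 2 * d * p * r + c * r ^ 2
        + 2 * k * (f * p + e * r) + a * k ^ 2 := ⟨_, rfl⟩
    obtain ⟨d', hd'⟩ : ∃ d', d' = b * p * q + d * (p * s + q * r) + c * r * s + k * e' := ⟨_, rfl⟩
    obtain ⟨c', hc'⟩ : ∃ c', c' = b * q ^ 2 + 2 * d * q * s + c * s ^ 2 := ⟨_, rfl⟩
    have hA' : a * b' - f' ^ 2 = A * p ^ 2 + 2 * B * p * r + C * r ^ 2 := by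
      rw [hA, hB, hC, hb', hf']; ring
    have hdet' : a * b' * c' + 2 * d' * e' * f' - a * d' ^ 2 - b' * e' ^ 2 - c' * f' ^ 2 = 1 := by
      have : a * b' * c' + 2 * d' * e' * f' - a * d' ^ 2 - b' * e' ^ 2 - c' * f' ^ 2 =
          (a * b * c + 2 * d * e * f - a * d ^ 2 - b * e ^ 2 - c * f ^ 2)
            * (p * s - q * r) ^ 2 := by
        rw [hd', hc', hb', hf', he']; ring
      rw [this, hdet, h1]; ring
    rw [← hA'] at h2 h3
    rw [← hf'] at hk1 hk2
    obtain ⟨hb0, hba⟩ := second_coeff_lt_of_reduced (by omega) (abs_le.2 ⟨by linarith, by linarith⟩)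
      h2 h3
    obtain ⟨y', hy'⟩ : ∃ y', y' = s * y - q * z := ⟨_, rfl⟩
    obtain ⟨z', hz'⟩ : ∃ z', z' = p * z - r * y := ⟨_, rfl⟩
    have hy : y = p * y' + q * z' := by rw [hy', hz']; linear_combination -y * h1
    have hz : z = r * y' + s * z' := by rw [hy', hz']; linear_combination -z * h1
    obtain ⟨x', hx'⟩ : ∃ x', x = x' + k * y' := ⟨x - k * y', by ring⟩
    obtain ⟨u, v, w, h⟩ := ih b'.toNat (by omega) b' a c' e' d' f' hb0 (by linarith)
      (by linear_combination hdet') y' x' z' rfl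
    refine ⟨u, v, w, h ▸ ?_⟩
    rw [hx', hy, hz, hd', hc', hb', hf', he']
    ring

/-! ### Sums of three squares and three triangular numbers -/

open NumberTheorySymbols in
/-- For a prime `p ≡ 1 (mod 4)` and `b ≡ 1 (mod 8)` such that `2 p ≡ -1 (mod b)`, reciprocity
makes `-b` a square modulo `p`: `(-b/p) = (p/b) = (-2p/b) = (1/b) = 1`. -/
lemma isSquare_neg_zmod {p b : ℕ} [Fact p.Prime] (hp : p % 4 = 1) (hb : b % 8 = 1)
    (hpb : (b : ℤ) ∣ 2 * p + 1) : IsSquare ((-b : ℤ) : ZMod p) := by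
  apply ZMod.isSquare_of_jacobiSym_eq_one
  have hb' : Odd b := Nat.odd_iff.2 (by omega)
  have h2 : J(-2 | b) = 1 := by
    rw [jacobiSym.at_neg_two hb', ZMod.χ₈'_nat_eq_if_mod_eight]
    simp [hb, show b % 2 = 1 by omega]
  have h3 : J(-2 * p | b) = 1 := by
    rw [← jacobiSym.one_left b]
    refine jacobiSym.mod_left' (Int.modEq_iff_dvd.2 ?_)
    rwa [show (1 : ℤ) - -2 * p = 2 * p + 1 by ring]
  rw [jacobiSym.neg _ (Nat.odd_iff.2 (by omega)), ZMod.χ₄_nat_one_mod_four hp, one_mul,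
    ← jacobiSym.quadratic_reciprocity_one_mod_four hp hb', ← h3, jacobiSym.mul_left, h2, one_mul]

/-- Every `N ≡ 3 (mod 8)` is a sum of three squares. -/
theorem eq_sum_three_sq_of_mod_eight_eq_three (t : ℕ) :
    ∃ u v w : ℤ, (8 * t + 3 : ℤ) = u ^ 2 + v ^ 2 + w ^ 2 := by
  -- Dirichlet's theorem gives a prime `p` for which `2 p + 1` is a multiple `b N` of `N = 8 t + 3`
  obtain ⟨p, hpgt, hp, hmod⟩ := Nat.forall_exists_prime_gt_and_modEq (4 * t + 1)
    (q := 4 * (8 * t + 3)) (a := 4 * t + 1) (by omega) (by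
      refine Nat.Coprime.mul_right ?_ ?_
      · have : Nat.Coprime (1 + 4 * t) 4 := by simp
        rwa [add_comm] at this
      · rw [show 8 * t + 3 = 1 + 2 * (4 * t + 1) by ring]
        simp)
  have := Fact.mk hp
  obtain ⟨v, hv⟩ := (Nat.modEq_iff_dvd' hpgt.le).1 hmod.symm
  have hpv : p = 4 * (8 * t + 3) * v + (4 * t + 1) := by omega
  obtain ⟨b, hb⟩ : ∃ b : ℕ, b = 8 * v + 1 := ⟨_, rfl⟩
  have hbp : (b : ℤ) * (8 * t + 3) = 2 * p + 1 := by
    rw [hb, hpv]; push_cast; ring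
  have hsq : IsSquare ((-b : ℤ) : ZMod p) :=
    isSquare_neg_zmod (by rw [hpv, mul_assoc]; omega) (by omega) ⟨8 * t + 3, hbp.symm⟩
  -- an odd square root of `-b` modulo `p` is a square root modulo `2 p`
  obtain ⟨x, hxodd, hx⟩ : ∃ x : ℤ, Odd x ∧ (p : ℤ) ∣ x ^ 2 + b := by
    obtain ⟨y, hy⟩ := hsq
    obtain ⟨x, rfl⟩ := ZMod.intCast_surjective y
    have hx : (p : ℤ) ∣ x ^ 2 + b := by
      rw [← ZMod.intCast_zmod_eq_zero_iff_dvd]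
      push_cast at hy ⊢
      rw [← neg_neg (b : ZMod p), hy]; ring
    rcases Int.even_or_odd x with he | ho
    · refine ⟨x + p, he.add_odd ?_, ?_⟩
      · exact_mod_cast (Nat.odd_iff.2 (by rw [hpv, mul_assoc]; omega) : Odd p)
      · rw [show (x + p) ^ 2 + (b : ℤ) = x ^ 2 + b + p * (2 * x + p) by ring]
        exact dvd_add hx (dvd_mul_right _ _)
    · exact ⟨x, ho, hx⟩
  have hx2 : (2 : ℤ) * p ∣ x ^ 2 + b := by
    refine IsCoprime.mul_dvd ?_ ?_ hx
    · exact Nat.isCoprime_iff_coprime.2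
        (Nat.coprime_two_left.2 (Nat.odd_iff.2 (by rw [hpv, mul_assoc]; omega)))
    · exact (hxodd.pow.add_odd (by rw [hb]; exact ⟨4 * v, by push_cast; ring⟩)).two_dvd
  obtain ⟨a, ha⟩ := hx2
  have hp0 : (0 : ℤ) < p := by exact_mod_cast hp.pos
  have hb0 : (0 : ℤ) < b := by omega
  have ha0 : 0 < a := by
    by_contra! h
    nlinarith [sq_nonneg x]
  obtain ⟨u, v, w, h⟩ := ternary_unimodular_eq_sum_three_sq a (2 * p) (8 * t + 3) 0 1 x ha0
    (by linarith) (by linear_combination hbp - (8 * t + 3) * ha) 0 0 1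
  exact ⟨u, v, w, by linear_combination h⟩

/-- **Gauss's Eureka theorem**: every natural number is a sum of three triangular numbers. -/
theorem exists_sum_three_triangular (t : ℕ) :
    ∃ a b c : ℕ, 2 * t = a * (a + 1) + b * (b + 1) + c * (c + 1) := by
  obtain ⟨u, v, w, h⟩ := eq_sum_three_sq_of_mod_eight_eq_three t
  have hodd (x y z : ℤ) (h : (8 * t + 3 : ℤ) = x ^ 2 + y ^ 2 + z ^ 2) :
      ∃ a : ℕ, x ^ 2 = 4 * (a * (a + 1)) + 1 := by
    obtain ⟨a, ha⟩ : Odd x.natAbs := by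
      rw [Int.natAbs_odd, Int.odd_iff]
      by_contra hx
      -- squares are `0` or `1` modulo `4`, and the sum is `3` modulo `4`
      have hsq (y : ℤ) : y ^ 2 % 4 = y % 2 := by
        rcases Int.even_or_odd' y with ⟨k, rfl | rfl⟩ <;> ring_nf <;> omega
      have hx4 := hsq x
      have hy4 := hsq y
      have hz4 := hsq z
      omega
    refine ⟨a, ?_⟩
    rw [← Int.natAbs_sq, ha]; push_cast; ring
  obtain ⟨a, ha⟩ := hodd u v w h
  obtain ⟨b, hb⟩ := hodd v u w (by linarith)
  obtain ⟨c, hc⟩ := hodd w u v (by linarith)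
  refine ⟨a, b, c, ?_⟩
  zify
  linarith

/-! ### Sums of two triangular numbers -/

/-- Consecutive integers multiply to twice a triangular number, also for negative factors. -/
lemma exists_nat_mul_succ_eq (k : ℤ) : ∃ a : ℕ, (a * (a + 1) : ℤ) = k * (k + 1) := by
  rcases le_or_gt 0 k with h | h
  · exact ⟨k.toNat, by rw [Int.toNat_of_nonneg h]⟩
  · exact ⟨(-k - 1).toNat, by rw [Int.toNat_of_nonneg (by omega)]; ring⟩

lemma evenExponents_iff {a : ℕ} (ha : a ≠ 0) :
    EvenExponents a ↔ ∃ x y : ℕ, a = x ^ 2 + y ^ 2 := by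
  rw [Nat.eq_sq_add_sq_iff]
  constructor
  · intro h q hq hq4
    obtain ⟨hp, hd, -⟩ := Nat.mem_primeFactors.1 hq
    rw [← Nat.factorization_def a hp]
    exact h q hp hd hq4
  · intro h p hp hd hp4
    rw [Nat.factorization_def a hp]
    exact h p (Nat.mem_primeFactors.2 ⟨hp, hd, ha⟩) hp4

/-- `e` is a sum of two triangular numbers exactly when `4 e + 1` is a sum of two squares:
`2 a (a + 1) + 2 b (b + 1) + 1 = (a + b + 1)² + (a - b)²`. -/
lemma exists_sum_two_triangular_iff (e : ℕ) :
    (∃ a b : ℕ, a * (a + 1) + b * (b + 1) = 2 * e) ↔ EvenExponents (4 * e + 1) := by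
  rw [evenExponents_iff (by omega)]
  constructor
  · rintro ⟨a, b, h⟩
    refine ⟨a + b + 1, ((a : ℤ) - b).natAbs, ?_⟩
    zify at h ⊢
    rw [sq_abs]
    linear_combination -2 * h
  · rintro ⟨x, y, h⟩
    zify at h
    have hodd : Odd ((x : ℤ) + y) := by
      have : Odd ((x : ℤ) ^ 2 + (y : ℤ) ^ 2) := ⟨2 * e, by rw [← h]; ring⟩
      simpa [Int.odd_add, Int.odd_pow, Int.even_pow] using this
    obtain ⟨k, hk⟩ := hodd
    -- `x = k + l + 1` and `y = k - l`
    obtain ⟨a, ha⟩ := exists_nat_mul_succ_eq k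
    obtain ⟨b, hb⟩ := exists_nat_mul_succ_eq (x - k - 1)
    refine ⟨a, b, ?_⟩
    zify
    have hy : (y : ℤ) = 2 * k + 1 - x := by linarith
    rw [hy] at h
    rw [ha, hb]
    linarith

/-! ### Multiplicity vectors as multisets -/

lemma sum_map_eq_sum_count {m : ℕ} {s : Multiset ℕ} (hs : ∀ k ∈ s, k ≤ m) (f : ℕ → ℤ) :
    (s.map f).sum = ∑ i : Fin (m + 1), f i * s.count (i : ℕ) := by
  rw [Fin.sum_univ_eq_sum_range (fun i => f i * (s.count i : ℤ)), Finset.sum_multiset_map_count]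
  simp only [nsmul_eq_mul, mul_comm]
  refine Finset.sum_subset (fun k hk => ?_) fun k _ hk => ?_
  · have := hs k (Multiset.mem_toFinset.1 hk)
    rw [Finset.mem_range]; omega
  · rw [Multiset.count_eq_zero.2 (by simpa using hk)]; simp

/-- If `s` has multiplicities `N_{m-k}`, then `F₂` counts its elements twice. -/
lemma F₂_eq_two_mul_card {m : ℕ} {N : Fin (m + 1) → ℤ} {s : Multiset ℕ} (hs : ∀ k ∈ s, k ≤ m)
    (hN : ∀ i : Fin (m + 1), (s.count (i : ℕ) : ℤ) = N i.rev) : F₂ m N = 2 * Multiset.card s := by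
  have h := sum_map_eq_sum_count hs (fun _ => 1)
  simp only [Multiset.map_const', Multiset.sum_replicate, hN] at h
  rw [F₂, ← Equiv.sum_comp Fin.revPerm]
  simpa using h.symm

/-- If `s` has multiplicities `N_{m-k}`, then `G₂ = 0` says that the numbers `6 k (k + 1)`, `k ∈ s`,
have average `m - 1`. -/
lemma G₂_eq {m : ℕ} {N : Fin (m + 1) → ℤ} {s : Multiset ℕ} (hs : ∀ k ∈ s, k ≤ m)
    (hN : ∀ i : Fin (m + 1), (s.count (i : ℕ) : ℤ) = N i.rev) :
    G₂ m N = 6 * ((s.map fun k => k * (k + 1)).sum : ℕ) - (m - 1) * Multiset.card s := by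
  have h := sum_map_eq_sum_count hs (fun k => 6 * (k : ℤ) * (k + 1) - (m - 1))
  simp only [hN] at h
  rw [G₂, ← h, Multiset.sum_map_sub]
  simp only [mul_assoc, Multiset.sum_map_mul_left]
  simp [mul_comm]

/-- A value of `F₂` on `Z₂` is twice the size of a nonempty multiset of indices on which
`6 k (k + 1)` has average `d = m - 1`. -/
lemma exists_multiset_of_mem {d : ℕ} {x : ℤ} (hx : x ∈ F₂ (d + 1) '' Z₂ (d + 1)) :
    ∃ s : Multiset ℕ, 0 < Multiset.card s ∧ x = 2 * Multiset.card s ∧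
      6 * (s.map fun k => k * (k + 1)).sum = d * Multiset.card s := by
  obtain ⟨N, ⟨hN0, hF, hG⟩, rfl⟩ := hx
  set s : Multiset ℕ := ∑ i : Fin (d + 1 + 1), (N i.rev).toNat • {(i : ℕ)} with hsdef
  have hs : ∀ k ∈ s, k ≤ d + 1 := by
    intro k hk
    obtain ⟨i, -, hi⟩ := Multiset.mem_sum.1 hk
    have := Multiset.mem_singleton.1 (Multiset.mem_of_mem_nsmul hi)
    omega
  have hN : ∀ i : Fin (d + 1 + 1), (s.count (i : ℕ) : ℤ) = N i.rev := by
    intro i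
    simp [hsdef, Multiset.count_sum', Multiset.count_singleton, Fin.val_inj, hN0]
  have h1 := F₂_eq_two_mul_card hs hN
  refine ⟨s, by omega, h1, ?_⟩
  have h2 := G₂_eq hs hN
  rw [hG] at h2
  zify
  push_cast at h2 ⊢
  linarith

/-- Converse of `exists_multiset_of_mem` for at most `12` elements. The bound on
the number of elements makes the constraint `k ≤ m` in the index set automatic. -/
lemma mem_of_multiset {d : ℕ} {s : Multiset ℕ} (h0 : 0 < Multiset.card s)
    (h12 : Multiset.card s ≤ 12)
    (h : 6 * (s.map fun k => k * (k + 1)).sum = d * Multiset.card s) :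
    (2 * Multiset.card s : ℤ) ∈ F₂ (d + 1) '' Z₂ (d + 1) := by
  have hs : ∀ k ∈ s, k ≤ d + 1 := by
    intro k hk
    have h1 : k * (k + 1) ≤ (s.map fun k => k * (k + 1)).sum :=
      Multiset.single_le_sum (fun _ _ => Nat.zero_le _) _ (Multiset.mem_map_of_mem _ hk)
    by_contra! hlt
    have h2 : d * Multiset.card s ≤ d * 12 := Nat.mul_le_mul_left _ h12
    have h3 : (d + 2) * (d + 3) ≤ k * (k + 1) := Nat.mul_le_mul (by omega) (by omega)
    nlinarith
  have hN : ∀ i : Fin (d + 1 + 1), (s.count (i : ℕ) : ℤ) =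
    (fun j : Fin (d + 1 + 1) => (s.count (j.rev : ℕ) : ℤ)) i.rev := by simp
  have hF := F₂_eq_two_mul_card (N := fun j => (s.count (j.rev : ℕ) : ℤ)) hs hN
  refine ⟨_, ⟨fun i => by positivity, by omega, ?_⟩, hF⟩
  rw [G₂_eq hs hN]
  zify at h
  push_cast at h ⊢
  linarith

/-- Each `k (k + 1)` is even, so `G₂ = 0` forces `12 ∣ d N`, equivalently `12 ∣ gcd(d, 12) N`. -/
lemma dvd_of_mem {d : ℕ} {x : ℤ} (hx : x ∈ F₂ (d + 1) '' Z₂ (d + 1)) :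
    ∃ N : ℕ, 0 < N ∧ x = 2 * N ∧ 12 ∣ Nat.gcd d 12 * N := by
  obtain ⟨s, h0, hx, h⟩ := exists_multiset_of_mem hx
  refine ⟨_, h0, hx, ?_⟩
  rw [← Nat.gcd_mul_right]
  refine Nat.dvd_gcd ?_ (dvd_mul_right _ _)
  have h2 : 2 ∣ (s.map fun k => k * (k + 1)).sum :=
    Multiset.dvd_sum fun a ha => by
      obtain ⟨k, -, rfl⟩ := Multiset.mem_map.1 ha
      exact (Nat.even_mul_succ_self k).two_dvd
  rw [← h]
  exact mul_dvd_mul (dvd_refl 6) h2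

/-- By the three triangular numbers theorem, for `3 ≤ N ≤ 12` divisibility is the only obstruction
to `2 N` being a value of `F₂`. -/
lemma mem_of_dvd {d N : ℕ} (h3 : 3 ≤ N) (h12 : N ≤ 12) (h : 12 ∣ Nat.gcd d 12 * N) :
    (2 * N : ℤ) ∈ F₂ (d + 1) '' Z₂ (d + 1) := by
  obtain ⟨t, ht⟩ := h.trans (mul_dvd_mul_right (Nat.gcd_dvd_left d 12) N)
  obtain ⟨a, b, c, habc⟩ := exists_sum_three_triangular t
  have hcard : Multiset.card ({a, b, c} + Multiset.replicate (N - 3) 0) = N := by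
    simp; omega
  have := mem_of_multiset (d := d) (s := {a, b, c} + Multiset.replicate (N - 3) 0)
    (by omega) (by omega) (by rw [hcard]; simp; linarith)
  rwa [hcard] at this

lemma two_mem_iff (d : ℕ) :
    2 ∈ F₂ (d + 1) '' Z₂ (d + 1) ↔ ∃ a : ℕ, 6 * (a * (a + 1)) = d := by
  constructor
  · intro hx
    obtain ⟨s, h0, hx, h⟩ := exists_multiset_of_mem hx
    obtain ⟨a, rfl⟩ := Multiset.card_eq_one.1 (by omega : Multiset.card s = 1)
    exact ⟨a, by simpa using h⟩
  · rintro ⟨a, h⟩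
    simpa using mem_of_multiset (d := d) (s := {a}) (by simp) (by simp) (by simpa using h)

lemma four_mem_iff (e : ℕ) :
    4 ∈ F₂ (6 * e + 1) '' Z₂ (6 * e + 1) ↔ EvenExponents (4 * e + 1) := by
  rw [← exists_sum_two_triangular_iff]
  constructor
  · intro hx
    obtain ⟨s, h0, hx, h⟩ := exists_multiset_of_mem hx
    obtain ⟨a, b, rfl⟩ := Multiset.card_eq_two.1 (by omega : Multiset.card s = 2)
    simp at h
    exact ⟨a, b, by linarith⟩
  · rintro ⟨a, b, h⟩
    simpa using mem_of_multiset (d := 6 * e) (s := {a, b}) (by simp) (by simp)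
      (by simp; linarith)

/-! ### The values of `B` -/

lemma isLeast_B (d : ℕ) :
    IsLeast (F₂ (d + 1) '' Z₂ (d + 1)) (B (2 * (d + 1) + 1)) := by
  have hbdd : BddBelow (F₂ (d + 1) '' Z₂ (d + 1)) := ⟨0, fun x hx => by
    obtain ⟨N, -, rfl, -⟩ := dvd_of_mem hx
    positivity⟩
  rw [B, show (2 * (d + 1) + 1) / 2 = d + 1 by omega]
  exact ⟨Int.csInf_mem ⟨_, mem_of_dvd (N := 12) (by simp) le_rfl (dvd_mul_left _ _)⟩ hbdd,
    fun x hx => csInf_le hbdd hx⟩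

lemma B_eq_of_isLeast {d : ℕ} {v : ℤ} (hv : v ∈ F₂ (d + 1) '' Z₂ (d + 1))
    (hle : ∀ x ∈ F₂ (d + 1) '' Z₂ (d + 1), v ≤ x) : B (2 * (d + 1) + 1) = v :=
  (isLeast_B d).unique ⟨hv, hle⟩

lemma B_mul_gcd {d : ℕ} (hr : Nat.gcd d 12 ≤ 4) : B (2 * (d + 1) + 1) * Nat.gcd d 12 = 24 := by
  obtain ⟨N, hN⟩ := Nat.gcd_dvd_right d 12
  have hr0 : 0 < Nat.gcd d 12 := Nat.gcd_pos_of_pos_right _ (by norm_num)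
  have hB : B (2 * (d + 1) + 1) = 2 * N := by
    refine B_eq_of_isLeast (mem_of_dvd ?_ ?_ hN.dvd) fun x hx => ?_
    · by_contra! h
      have := Nat.mul_le_mul hr (by omega : N ≤ 2)
      omega
    · nlinarith
    · obtain ⟨M, hM, rfl, h⟩ := dvd_of_mem hx
      have := Nat.le_of_dvd (by positivity) h
      have h2 : N ≤ M := le_of_mul_le_mul_left (by linarith) hr0
      omega
  rw [hB]
  zify at hN
  linarith

lemma B_of_gcd_eq_six {e : ℕ} (hr : Nat.gcd (6 * e) 12 = 6) :
    (EvenExponents (4 * e + 1) → B (2 * (6 * e + 1) + 1) = 4) ∧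
    (¬ EvenExponents (4 * e + 1) → B (2 * (6 * e + 1) + 1) = 8) := by
  constructor <;> intro h
  · refine B_eq_of_isLeast ((four_mem_iff e).2 h) fun x hx => ?_
    obtain ⟨N, hN, rfl, hd⟩ := dvd_of_mem hx
    rw [hr] at hd
    omega
  · refine B_eq_of_isLeast (mem_of_dvd (N := 4) (by simp) (by simp) (by simp [hr]))
      fun x hx => ?_
    obtain ⟨N, hN, rfl, hd⟩ := dvd_of_mem hx
    rw [hr] at hd
    have : N ≠ 2 := by
      rintro rfl
      exact h ((four_mem_iff e).1 hx)
    omega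

lemma B_of_gcd_eq_twelve {e : ℕ} (hr : Nat.gcd (6 * e) 12 = 12) :
    ((∃ a : ℕ, 6 * (a * (a + 1)) = 6 * e) → B (2 * (6 * e + 1) + 1) = 2) ∧
    ((¬ ∃ a : ℕ, 6 * (a * (a + 1)) = 6 * e) → EvenExponents (4 * e + 1) →
      B (2 * (6 * e + 1) + 1) = 4) ∧
    ((¬ ∃ a : ℕ, 6 * (a * (a + 1)) = 6 * e) → ¬ EvenExponents (4 * e + 1) →
      B (2 * (6 * e + 1) + 1) = 6) := by
  simp only [← two_mem_iff, ← four_mem_iff]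
  refine ⟨fun h => B_eq_of_isLeast h fun x hx => ?_,
    fun h1 h2 => B_eq_of_isLeast h2 fun x hx => ?_,
    fun h1 h2 => B_eq_of_isLeast (mem_of_dvd (N := 3) (by simp) (by simp) (by simp [hr]))
      fun x hx => ?_⟩ <;>
  obtain ⟨N, hN, rfl, hd⟩ := dvd_of_mem hx
  · omega
  · have : N ≠ 1 := by rintro rfl; exact h1 hx
    omega
  · have : N ≠ 1 := by rintro rfl; exact h1 hx
    have : N ≠ 2 := by rintro rfl; exact h2 hx
    omega

lemma isTriangular_iff (d : ℕ) :
    IsTriangular ((((2 * (d + 1) + 1 : ℕ) : ℚ) - 3) / 24) ↔ ∃ a : ℕ, 6 * (a * (a + 1)) = d := by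
  refine exists_congr fun a => ?_
  rw [← Nat.cast_inj (R := ℚ)]
  push_cast
  constructor <;> intro h <;> linarith

lemma B_image_eq : B '' {n : ℕ | Odd n ∧ 3 ≤ n} = {2, 4, 6, 8, 12, 24} := by
  ext x
  simp only [Set.mem_image, Set.mem_ofPred_eq, Set.mem_insert_iff, Set.mem_singleton_iff]
  constructor
  · rintro ⟨n, ⟨⟨m, rfl⟩, hn⟩, rfl⟩
    obtain ⟨d, rfl⟩ : ∃ d, m = d + 1 := ⟨m - 1, by omega⟩
    have hdvd := Nat.gcd_dvd_right d 12
    by_cases h4 : Nat.gcd d 12 ≤ 4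
    · have h := B_mul_gcd h4
      generalize Nat.gcd d 12 = r at *
      interval_cases r <;> omega
    · obtain ⟨e, rfl⟩ : 6 ∣ d := by
        refine Nat.dvd_trans ?_ (Nat.gcd_dvd_left d 12)
        have := Nat.le_of_dvd (by norm_num) hdvd
        generalize Nat.gcd d 12 = r at *
        interval_cases r <;> omega
      have h612 : Nat.gcd (6 * e) 12 = 6 ∨ Nat.gcd (6 * e) 12 = 12 := by
        have := Nat.le_of_dvd (by norm_num) hdvd
        generalize Nat.gcd (6 * e) 12 = r at *
        interval_cases r <;> omega
      rcases h612 with h | h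
      · have := B_of_gcd_eq_six h
        tauto
      · have := B_of_gcd_eq_twelve h
        tauto
  · have key (d r : ℕ) (hr : Nat.gcd d 12 = r) (h4 : r ≤ 4) : B (2 * (d + 1) + 1) * r = 24 := by
      subst hr; exact B_mul_gcd h4
    rintro (rfl | rfl | rfl | rfl | rfl | rfl)
    · exact ⟨3, by decide, (B_of_gcd_eq_twelve (e := 0) (by norm_num)).1 ⟨0, by simp⟩⟩
    · exact ⟨15, by decide, (B_of_gcd_eq_six (e := 1) (by norm_num)).1
        ((exists_sum_two_triangular_iff 1).1 ⟨1, 0, by simp⟩)⟩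
    · have := key 4 4 (by norm_num) (by norm_num)
      exact ⟨11, by decide, by norm_num at this; omega⟩
    · have := key 3 3 (by norm_num) (by norm_num)
      exact ⟨9, by decide, by norm_num at this; omega⟩
    · have := key 2 2 (by norm_num) (by norm_num)
      exact ⟨7, by decide, by norm_num at this; omega⟩
    · have := key 1 1 (by norm_num) (by norm_num)
      exact ⟨5, by decide, by norm_num at this; omega⟩

end FixedPointBound

theorem mainTheorem4 :
    (∀ n m r : ℕ, n = 2 * m + 1 → 1 ≤ m → r = Int.gcd ((m : ℤ) - 1) 12 →
      IsLeast (FixedPointBound.F₂ m '' FixedPointBound.Z₂ m) (FixedPointBound.B n) ∧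
      (r ≤ 4 → (FixedPointBound.B n : ℚ) = 24 / (r : ℚ)) ∧
      (r = 6 →
        (FixedPointBound.EvenExponents (n / 3) → FixedPointBound.B n = 4) ∧
        (¬ FixedPointBound.EvenExponents (n / 3) → FixedPointBound.B n = 8)) ∧
      (r = 12 →
        (FixedPointBound.IsTriangular (((n : ℚ) - 3) / 24) → FixedPointBound.B n = 2) ∧
        (¬ FixedPointBound.IsTriangular (((n : ℚ) - 3) / 24) →
          FixedPointBound.EvenExponents (n / 3) → FixedPointBound.B n = 4) ∧
        (¬ FixedPointBound.IsTriangular (((n : ℚ) - 3) / 24) →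
          ¬ FixedPointBound.EvenExponents (n / 3) → FixedPointBound.B n = 6))) ∧
    FixedPointBound.B '' {n : ℕ | Odd n ∧ 3 ≤ n} = {2, 4, 6, 8, 12, 24} := by
  refine ⟨?_, FixedPointBound.B_image_eq⟩
  rintro n m r rfl hm hr
  obtain ⟨d, rfl⟩ : ∃ d, m = d + 1 := ⟨m - 1, by omega⟩
  have hr' : Nat.gcd d 12 = r := by
    rw [hr]
    push_cast
    rw [add_sub_cancel_right]
    rfl
  clear hr
  refine ⟨FixedPointBound.isLeast_B d, fun h4 => ?_, fun h6 => ?_, fun h12 => ?_⟩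
  · subst hr'
    have hr0 : (Nat.gcd d 12 : ℚ) ≠ 0 := by
      exact_mod_cast (Nat.gcd_pos_of_pos_right d (by norm_num)).ne'
    rw [eq_div_iff hr0]
    exact_mod_cast FixedPointBound.B_mul_gcd h4
  · obtain ⟨e, rfl⟩ : 6 ∣ d := h6 ▸ hr' ▸ Nat.gcd_dvd_left d 12
    rw [show (2 * (6 * e + 1) + 1) / 3 = 4 * e + 1 by omega]
    exact FixedPointBound.B_of_gcd_eq_six (hr'.trans h6)
  · obtain ⟨e, rfl⟩ : 6 ∣ d :=
      Nat.dvd_trans (by norm_num) (h12 ▸ hr' ▸ Nat.gcd_dvd_left d 12 : 12 ∣ d)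
    rw [show (2 * (6 * e + 1) + 1) / 3 = 4 * e + 1 by omega, FixedPointBound.isTriangular_iff]
    exact FixedPointBound.B_of_gcd_eq_twelve (hr'.trans h12)
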